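/- Let $n\ge 0$, $\mathbb{R}^n_+=(0,\infty)^n$ and $\mathbb{R}^n_{\ge0}=[0,\infty)^n$. Let $\phi:\mathbb{R}^n_{\ge 0}\to\mathbb{R}$ be a bounded (Lebesgue) measurable function that is rapidly decreasing, i.e. for every multi-index $\alpha\in\mathbb{Z}_{\ge0}^n$ one has $\epsilon^\alpha\phi(\epsilon)\to 0$ as $|\epsilon|\to\infty$ in $\mathbb{R}^n_{\ge0}$. Let $p(\epsilon)=\sum_{\alpha\in\mathcal A}a_\alpha\epsilon^\alpha$ be a complex Laurent polynomial in $n$ variables (for instance an ordinary polynomial), with $\mathcal A\subset\mathbb{Z}^n$ finite and all $a_\alpha\neq0$, and let $\Delta_p\subset\mathbb{R}^n$ be its Newton polytope, the convex hull of $\mathcal A$. For a non-empty face $\Gamma$ of $\Delta_p$, the truncated polynomial is $p_\Gamma(\epsilon)=\sum_{\alpha\in\mathcal A\cap\Gamma}a_\alpha\epsilon^\alpha$. Assume that $p$ is completely non-vanishing on $\mathbb{R}^n_+$, i.e. neither $p$ nor any truncated polynomial $p_\Gamma$ has a zero in $\mathbb{R}^n_+$. Then the integral $$\mathcal{M}_{\phi/p}(s)=\int_{\mathbb{R}^n_+}\frac{\epsilon_1^{s_1-1}\cdots\epsilon_n^{s_n-1}\,\phi(\epsilon)}{p(\epsilon)}\,d\epsilon$$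 converges absolutely for every $s$ in the tube domain $\{s\in\mathbb{C}^n:\operatorname{Re}(s)\in\Delta_p+\mathbb{R}^n_+\}$ (Minkowski sum), and $s\mapsto\mathcal{M}_{\phi/p}(s)$ is analytic on this domain. No assumption is made on the dimension of $\Delta_p$; in particular $\Delta_p$ may have empty interior. -/

import Mathlib

open Set Filter Topology MeasureTheory
open scoped Pointwise

noncomputable section

namespace NewtonMellin

/-- The open positive orthant `ℝ^n_+ = (0, ∞)^n`. -/
def posOrthant (n : ℕ) : Set (Fin n → ℝ) := {x | ∀ i, 0 < x i}

/-- The closed orthant `ℝ^n_{≥ 0} = [0, ∞)^n`. -/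
def nonnegOrthant (n : ℕ) : Set (Fin n → ℝ) := {x | ∀ i, 0 ≤ x i}

/-- The orthant `ℝ^n_+` as a subset of `ℂ^n`. -/
def complexPosOrthant (n : ℕ) : Set (Fin n → ℂ) :=
  (fun x i => (x i : ℂ)) '' posOrthant n

/-- Complex Laurent polynomials in `n` variables: finite sums `∑ a_α ε^α` with `α ∈ ℤ^n`.
Those with support in `ℕ^n` are the ordinary polynomials. -/
abbrev MvLaurent (n : ℕ) : Type := AddMonoidAlgebra ℂ (Fin n → ℤ)

/-- The value `∑ a_α z_1^{α_1} ⋯ z_n^{α_n}` of a Laurent polynomial at a point `z`. -/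
def MvLaurent.eval {n : ℕ} (p : MvLaurent n) (z : Fin n → ℂ) : ℂ :=
  ∑ α ∈ p.coeff.support, p.coeff α * ∏ i, z i ^ α i

/-- An integer exponent vector as a point of `ℝ^n`. -/
def realExponent {n : ℕ} (α : Fin n → ℤ) : Fin n → ℝ := fun i => (α i : ℝ)

/-- The Newton polytope: the convex hull of the exponents of the monomials of `p`. -/
def newtonPolytope {n : ℕ} (p : MvLaurent n) : Set (Fin n → ℝ) :=
  convexHull ℝ (realExponent '' (p.coeff.support : Set (Fin n → ℤ)))

/-- The non-empty faces of a convex set `P` in `ℝ^n`: the sets of points of `P` at which some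
linear functional attains its maximum over `P` (`P` itself being one of them). -/
def IsFace {n : ℕ} (P Γ : Set (Fin n → ℝ)) : Prop := Γ.Nonempty ∧ IsExposed ℝ P Γ

open Classical in
/-- The truncated polynomial `p_Γ`: the sum of the monomials of `p` with exponent in `Γ`. -/
def truncation {n : ℕ} (p : MvLaurent n) (Γ : Set (Fin n → ℝ)) : MvLaurent n :=
  AddMonoidAlgebra.ofCoeff (p.coeff.filter fun α => realExponent α ∈ Γ)

/-- `p` is completely non-vanishing on `O`: neither `p` nor any of its truncations to the faces of
its Newton polytope has a zero in `O`. -/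
def CompletelyNonvanishing {n : ℕ} (p : MvLaurent n) (O : Set (Fin n → ℂ)) : Prop :=
  (∀ z ∈ O, p.eval z ≠ 0) ∧
    ∀ Γ, IsFace (newtonPolytope p) Γ → ∀ z ∈ O, (truncation p Γ).eval z ≠ 0

/-- `φ` is rapidly decreasing on `ℝ^n_{≥ 0}`: for every multi-index `α`, `ε^α φ(ε) → 0` as
`|ε| → ∞` within `ℝ^n_{≥ 0}`. -/
def RapidlyDecreasing {n : ℕ} (φ : (Fin n → ℝ) → ℝ) : Prop :=
  ∀ α : Fin n → ℕ,
    Tendsto (fun ε => (∏ i, ε i ^ α i) * φ ε)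
      (Bornology.cobounded (Fin n → ℝ) ⊓ 𝓟 (nonnegOrthant n)) (𝓝 0)

/-- The integrand `ε^{s-1} g(ε)` of the Mellin transform of `g`. -/
def mellinIntegrand {n : ℕ} (g : (Fin n → ℝ) → ℂ) (s : Fin n → ℂ) (ε : Fin n → ℝ) : ℂ :=
  (∏ i, (ε i : ℂ) ^ (s i - 1)) * g ε

/-- The Mellin transform `s ↦ ∫_{ℝ^n_+} ε^{s-1} g(ε) dε`. -/
def mellinTransform {n : ℕ} (g : (Fin n → ℝ) → ℂ) (s : Fin n → ℂ) : ℂ :=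
  ∫ ε in posOrthant n, mellinIntegrand g s ε

/-- The quotient `φ / p` as a function of `ε ∈ ℝ^n`. -/
def quotient {n : ℕ} (φ : (Fin n → ℝ) → ℝ) (p : MvLaurent n) (ε : Fin n → ℝ) : ℂ :=
  (φ ε : ℂ) / p.eval (fun i => (ε i : ℂ))

/-- The tube `{s ∈ ℂ^n : Re s ∈ D}` over `D ⊆ ℝ^n`. -/
def tube {n : ℕ} (D : Set (Fin n → ℝ)) : Set (Fin n → ℂ) := {s | (fun i => (s i).re) ∈ D}

end NewtonMellin

end

/-!
The heart of the matter is a lower bound `∑ ε^α ≤ C |p(ε)|` on the positive orthant, the sum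
running over the exponents `α` of `p` (`exists_pos_mul_sum_exp_le_norm_eval`). In the coordinates
`ε = exp y` the monomials become exponentials of linear forms `α · y`. If the bound failed along a
sequence `y_k`, the vectors of normalized monomials `exp (α · y_k) / ∑ exp (β · y_k)` would have a
limit point in the simplex of exponents. The monomials with non-zero limit are those of a face of
the Newton polytope, because the part of `y_k` along which their mutual ratios are constant exposes
them. Their limiting ratios are attained at some point, at which the truncation of `p` to that face
vanishes, contrary to complete non-vanishing. No induction over faces is needed, and the dimension
of the polytope plays no role (`exists_pos_mul_sum_exp_le_norm`).

For `δ` in the Newton polytope, convexity gives `ε^δ ≤ ∑ ε^α ≤ C |p(ε)|`. If `Re s = δ + τ` with all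
`τ_i > 0`, the integrand is therefore at most `C ∏ ε_i^{τ_i - 1} |φ(ε)|`. Since `φ` is
`O(∏ (1 + ε_i^N)⁻¹)` for every `N`, a product of integrable one-variable functions dominates it, even
after multiplication by `∏ (ε_i^r + ε_i^{-r})` for a small `r > 0`
(`exists_integrable_norm_mul_exp_logPairing`).

Analyticity in several variables follows from the same domination. Moving the parameter by `h`
multiplies the integrand by `exp (∑ h_i log ε_i)`, and the exponential series of this linear form in
`h` integrates term by term to a power series (`analyticAt_integral_mul_cexp`).
-/

namespace NewtonMellin

/-! ### Lower bounds for sums of exponentials -/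

/-- Every linear map has a generalized inverse: split it onto its range, then extend to the whole
target. -/
theorem exists_partial_inverse {K V W : Type*} [DivisionRing K] [AddCommGroup V] [Module K V]
    [AddCommGroup W] [Module K W] (T : V →ₗ[K] W) :
    ∃ S : W →ₗ[K] V, ∀ y, T (S (T y)) = T y := by
  obtain ⟨S₀, hS₀⟩ := T.rangeRestrict.exists_rightInverse_of_surjective T.range_rangeRestrict
  obtain ⟨S, hS⟩ := LinearMap.exists_extend S₀
  refine ⟨S, fun y => ?_⟩
  have h1 := LinearMap.congr_fun hS (T.rangeRestrict y)
  have h2 := congrArg Subtype.val (LinearMap.congr_fun hS₀ (T.rangeRestrict y))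
  simp only [LinearMap.comp_apply, Submodule.subtype_apply, LinearMap.id_apply,
    LinearMap.codRestrict_apply] at h1 h2
  simp only [LinearMap.rangeRestrict] at h1 h2
  rw [h1]
  exact h2

/-- The norm of `∑ a i * exp (l i y)`, with linear forms `l i`, is at least a positive constant times
`∑ exp (l i y)`, provided that none of the partial sums over faces `F` (the sets of indices where
some vector `v` maximizes `i ↦ l i v`) has a zero. Along a
sequence violating the bound, the normalized exponentials converge to a point `w'` of the simplex.
The support `F` of `w'` is such a face, `w'` is proportional on `F` to `exp (l i y')` for some `y'`,
and the partial sum over `F` vanishes at `y'`. -/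
theorem exists_pos_mul_sum_exp_le_norm {ι V : Type*} [Fintype ι] [Nonempty ι] [AddCommGroup V]
    [Module ℝ V] (l : ι → V →ₗ[ℝ] ℝ) (a : ι → ℂ)
    (h : ∀ (F : Finset ι) (v : V) (c : ℝ), F.Nonempty → (∀ i ∈ F, l i v = c) →
      (∀ i ∉ F, l i v < c) → ∀ y, ∑ i ∈ F, a i * (Real.exp (l i y) : ℂ) ≠ 0) :
    ∃ c > 0, ∀ y, c * ∑ i, Real.exp (l i y) ≤ ‖∑ i, a i * (Real.exp (l i y) : ℂ)‖ := by
  classical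
  by_contra! hcon
  choose y hy using fun k : ℕ => hcon (1 / ((k : ℝ) + 1)) (by positivity)
  set Z : ℕ → ℝ := fun k => ∑ i, Real.exp (l i (y k)) with hZ
  have hZpos : ∀ k, 0 < Z k := fun k =>
    Finset.sum_pos (fun i _ => Real.exp_pos _) Finset.univ_nonempty
  set w : ℕ → ι → ℝ := fun k i => Real.exp (l i (y k)) / Z k with hw
  have hwpos : ∀ k i, 0 < w k i := fun k i => div_pos (Real.exp_pos _) (hZpos k)
  have hmem : ∀ k, w k ∈ stdSimplex ℝ ι := fun k =>
    ⟨fun i => (hwpos k i).le, by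
      simp only [hw]
      rw [← Finset.sum_div]
      exact div_self (hZpos k).ne'⟩
  obtain ⟨w', hw', κ, hκ, hlim⟩ := (isCompact_stdSimplex ℝ ι).tendsto_subseq hmem
  have hlim' : ∀ i, Tendsto (fun k => w (κ k) i) atTop (𝓝 (w' i)) := tendsto_pi_nhds.1 hlim
  -- the weighted sum of the coefficients vanishes in the limit
  have hzero : ∑ i, a i * (w' i : ℂ) = 0 := by
    have h1 : Tendsto (fun k => ∑ i, a i * (w (κ k) i : ℂ)) atTop (𝓝 (∑ i, a i * (w' i : ℂ))) :=
      tendsto_finsetSum _ fun i _ => tendsto_const_nhds.mul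
        ((Complex.continuous_ofReal.tendsto _).comp (hlim' i))
    have h2 : Tendsto (fun k => ∑ i, a i * (w k i : ℂ)) atTop (𝓝 0) := by
      refine squeeze_zero_norm (fun k => ?_) tendsto_one_div_add_atTop_nhds_zero_nat
      have : ∑ i, a i * (w k i : ℂ) = (∑ i, a i * (Real.exp (l i (y k)) : ℂ)) / (Z k : ℂ) := by
        rw [Finset.sum_div]
        refine Finset.sum_congr rfl fun i _ => ?_
        simp only [hw]
        push_cast
        ring
      rw [this, norm_div, Complex.norm_real, Real.norm_of_nonneg (hZpos k).le,
        div_le_iff₀ (hZpos k)]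
      exact (hy k).le
    exact tendsto_nhds_unique h1 (h2.comp hκ.tendsto_atTop)
  set F : Finset ι := Finset.univ.filter fun i => 0 < w' i with hF
  have hmemF : ∀ i, i ∈ F ↔ 0 < w' i := fun i => by simp [hF]
  have hnotF : ∀ i, i ∉ F → w' i = 0 := fun i hi =>
    le_antisymm (not_lt.1 fun hlt => hi ((hmemF i).2 hlt)) (hw'.1 i)
  obtain ⟨b, hb⟩ : F.Nonempty := by
    by_contra hne
    rw [Finset.not_nonempty_iff_eq_empty] at hne
    have : ∑ i, w' i = 0 := Finset.sum_eq_zero fun i _ => hnotF i (by simp [hne])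
    rw [hw'.2] at this
    exact one_ne_zero this
  have hbpos := (hmemF b).1 hb
  have hdiff : ∀ k i, l i (y k) - l b (y k) = Real.log (w k i / w k b) := fun k i => by
    simp only [hw]
    rw [div_div_div_cancel_right₀ (hZpos k).ne', ← Real.exp_sub, Real.log_exp]
  -- the differences of the exponents converge on `F` and tend to `-∞` off `F`
  have hconv : ∀ i ∈ F, Tendsto (fun k => l i (y (κ k)) - l b (y (κ k))) atTop
      (𝓝 (Real.log (w' i / w' b))) := fun i hi => by
    simp only [hdiff]
    have hi' := (hmemF i).1 hi
    exact ((hlim' i).div (hlim' b) hbpos.ne').log (div_pos hi' hbpos).ne'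
  have hbot : ∀ i ∉ F, Tendsto (fun k => l i (y (κ k)) - l b (y (κ k))) atTop atBot :=
    fun i hi => by
    simp only [hdiff]
    refine Real.tendsto_log_nhdsGT_zero.comp ?_
    refine tendsto_nhdsWithin_iff.2 ⟨?_, Eventually.of_forall fun k =>
      div_pos (hwpos _ _) (hwpos _ _)⟩
    have := (hlim' i).div (hlim' b) hbpos.ne'
    rwa [hnotF i hi, zero_div] at this
  -- `T` records the differences on `F`. With a generalized inverse `S` of it, the limit of `T y` is
  -- attained at `S t`, and the components `y - S (T y)` in the kernel of `T` expose `F`.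
  let T : V →ₗ[ℝ] (F → ℝ) := LinearMap.pi fun i => l i - l b
  obtain ⟨S, hS⟩ := exists_partial_inverse T
  set t : F → ℝ := fun i => Real.log (w' i / w' b) with ht
  have hT : Tendsto (fun k => T (y (κ k))) atTop (𝓝 t) :=
    tendsto_pi_nhds.2 fun i => hconv i i.2
  have hcont : ∀ g : (F → ℝ) →ₗ[ℝ] ℝ, Tendsto (fun k => g (T (y (κ k)))) atTop (𝓝 (g t)) :=
    fun g => (g.continuous_of_finiteDimensional.tendsto t).comp hT
  have hTS : ∀ i ∈ F, l i (S t) - l b (S t) = Real.log (w' i / w' b) := fun i hi => by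
    refine tendsto_nhds_unique (hcont ((l i - l b).comp S)) ?_
    refine (hconv i hi).congr fun k => ?_
    exact (congrFun (hS (y (κ k))) ⟨i, hi⟩).symm
  have hker : ∀ k, ∀ i ∈ F, l i (y k - S (T (y k))) = l b (y k - S (T (y k))) := fun k i hi => by
    have : (l i - l b) (S (T (y k))) = (l i - l b) (y k) := congrFun (hS (y k)) ⟨i, hi⟩
    simp only [LinearMap.sub_apply] at this
    simp only [map_sub]
    linarith
  have hev : ∀ i ∉ F, ∀ᶠ k in atTop, l i (y (κ k) - S (T (y (κ k)))) <
      l b (y (κ k) - S (T (y (κ k)))) := fun i hi => by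
    have h1 := (hbot i hi).atBot_add (hcont ((l b - l i).comp S))
    filter_upwards [h1.eventually (eventually_lt_atBot 0)] with k hk
    simp only [LinearMap.comp_apply, LinearMap.sub_apply] at hk
    simp only [map_sub]
    linarith
  obtain ⟨k, hk⟩ := (eventually_all.2 fun i =>
    eventually_imp_distrib_left.2 (hev i)).exists
  refine h F (y (κ k) - S (T (y (κ k)))) _ ⟨b, hb⟩ (hker (κ k)) hk (S t) ?_
  have hexp : ∀ i ∈ F, a i * (Real.exp (l i (S t)) : ℂ) =
      (Real.exp (l b (S t)) / w' b : ℝ) * (a i * (w' i : ℂ)) := fun i hi => by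
    have : Real.exp (l i (S t)) = Real.exp (l b (S t)) / w' b * w' i := by
      rw [show l i (S t) = l b (S t) + Real.log (w' i / w' b) by rw [← hTS i hi]; ring,
        Real.exp_add, Real.exp_log (div_pos ((hmemF i).1 hi) hbpos)]
      ring
    rw [this]
    push_cast
    ring
  rw [Finset.sum_congr rfl hexp, ← Finset.mul_sum,
    Finset.sum_subset (Finset.subset_univ F) fun i _ hi => by simp [hnotF i hi], hzero, mul_zero]

/-! ### Lower bounds for completely non-vanishing Laurent polynomials -/

/-- The linear functional `y ↦ ∑ α_i y_i` on `ℝ^n`. -/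
def pairing {n : ℕ} (α : Fin n → ℝ) : (Fin n → ℝ) →ₗ[ℝ] ℝ := ∑ i, α i • LinearMap.proj i

theorem pairing_apply {n : ℕ} (α y : Fin n → ℝ) : pairing α y = ∑ i, α i * y i := by
  simp [pairing]

theorem pairing_comm {n : ℕ} (α y : Fin n → ℝ) : pairing α y = pairing y α := by
  simp [pairing_apply, mul_comm]

/-- In the coordinates `ε = exp y`, a Laurent monomial is the exponential of a linear form. -/
theorem prod_exp_zpow {n : ℕ} (α : Fin n → ℤ) (y : Fin n → ℝ) :
    ∏ i, ((Real.exp (y i) : ℝ) : ℂ) ^ α i = (Real.exp (pairing (realExponent α) y) : ℂ) := by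
  rw [pairing_apply, Real.exp_sum, Complex.ofReal_prod]
  refine Finset.prod_congr rfl fun i _ => ?_
  rw [realExponent, mul_comm, Real.exp_mul, Real.rpow_intCast, Complex.ofReal_zpow]

/-- The points of a convex hull where a linear functional attains its maximum form a face, and it
suffices to check maximality on the generating set. -/
theorem isFace_setOf_pairing_eq {n : ℕ} {A : Set (Fin n → ℝ)} {b v : Fin n → ℝ} (hb : b ∈ A)
    (hle : ∀ x ∈ A, pairing x v ≤ pairing b v) :
    IsFace (convexHull ℝ A) {x ∈ convexHull ℝ A | pairing x v = pairing b v} := by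
  have hle' : ∀ x ∈ convexHull ℝ A, pairing v x ≤ pairing v b := fun x hx =>
    convexHull_min (fun z hz => by
        rw [mem_ofPred_eq, pairing_comm v, pairing_comm v]
        exact hle z hz)
      (convex_halfSpace_le (pairing v).isLinear (pairing v b)) hx
  have hb' := subset_convexHull ℝ A hb
  refine ⟨⟨b, hb', rfl⟩, fun _ => ⟨LinearMap.toContinuousLinearMap (pairing v), ?_⟩⟩
  ext x
  simp only [mem_ofPred_eq, LinearMap.coe_toContinuousLinearMap']
  refine and_congr_right fun hx => ?_
  rw [pairing_comm x, pairing_comm b]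
  exact ⟨fun h z hz => (hle' z hz).trans h.ge, fun h => le_antisymm (hle' x hx) (h b hb')⟩

theorem eval_truncation {n : ℕ} (p : MvLaurent n) (Γ : Set (Fin n → ℝ)) (z : Fin n → ℂ)
    [DecidablePred fun α : Fin n → ℤ => realExponent α ∈ Γ] :
    (truncation p Γ).eval z =
      ∑ α ∈ p.coeff.support with realExponent α ∈ Γ, p.coeff α * ∏ i, z i ^ α i := by
  classical
  have : (truncation p Γ).coeff = p.coeff.filter fun α => realExponent α ∈ Γ := by
    simp only [truncation, AddMonoidAlgebra.coeff_ofCoeff]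
    congr
  rw [MvLaurent.eval, this, Finsupp.support_filter]
  refine Finset.sum_congr (by ext; simp) fun α hα => ?_
  rw [Finsupp.filter_apply_pos (fun α => realExponent α ∈ Γ) _ (Finset.mem_filter.1 hα).2]

theorem exp_mem_complexPosOrthant {n : ℕ} (y : Fin n → ℝ) :
    (fun i => ((Real.exp (y i) : ℝ) : ℂ)) ∈ complexPosOrthant n :=
  ⟨fun i => Real.exp (y i), fun _ => Real.exp_pos _, rfl⟩

/-- A completely non-vanishing Laurent polynomial is bounded below on the positive orthant, written
in the coordinates `ε = exp y`, by a multiple of the sum of its monomials. -/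
theorem exists_pos_mul_sum_exp_le_norm_eval {n : ℕ} {p : MvLaurent n}
    (hp : CompletelyNonvanishing p (complexPosOrthant n)) :
    ∃ c > 0, ∀ y : Fin n → ℝ,
      c * ∑ α ∈ p.coeff.support, Real.exp (pairing (realExponent α) y) ≤
        ‖p.eval fun i => ((Real.exp (y i) : ℝ) : ℂ)‖ := by
  classical
  have hne : Nonempty p.coeff.support := by
    rw [← not_isEmpty_iff]
    intro he
    refine hp.1 _ (exp_mem_complexPosOrthant 0) ?_
    -- the zero polynomial has zeros
    rw [MvLaurent.eval]
    exact Finset.sum_eq_zero fun α hα => (he.false ⟨α, hα⟩).elim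
  obtain ⟨c, hc, hle⟩ := exists_pos_mul_sum_exp_le_norm
    (fun α : p.coeff.support => pairing (realExponent (α : Fin n → ℤ)))
    (fun α => p.coeff α) fun F v d hF hFeq hFlt y hzero => by
      obtain ⟨b, hb⟩ := hF
      have hface := isFace_setOf_pairing_eq (v := v) (b := realExponent b.1)
        (A := realExponent '' (p.coeff.support : Set (Fin n → ℤ)))
        (mem_image_of_mem _ b.2) (by
          rintro _ ⟨α, hα, rfl⟩
          rw [hFeq b hb]
          by_cases h : (⟨α, hα⟩ : p.coeff.support) ∈ F
          · exact (hFeq _ h).le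
          · exact (hFlt _ h).le)
      refine hp.2 _ hface _ (exp_mem_complexPosOrthant y) ?_
      rw [eval_truncation, ← hzero]
      symm
      refine Finset.sum_bij (fun α _ => α.1) (fun α hα => ?_) (fun _ _ _ _ h => Subtype.ext h)
        (fun α hα => ?_) fun α _ => by rw [prod_exp_zpow]
      · exact Finset.mem_filter.2 ⟨α.2, subset_convexHull ℝ _ (mem_image_of_mem _ α.2),
          (hFeq α hα).trans (hFeq b hb).symm⟩
      · obtain ⟨hα, -, heq⟩ := Finset.mem_filter.1 hα
        refine ⟨⟨α, hα⟩, ?_, rfl⟩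
        by_contra h
        exact absurd (heq.trans (hFeq b hb)) (hFlt ⟨α, hα⟩ h).ne
  refine ⟨c, hc, fun y => ?_⟩
  have := hle y
  rw [Finset.sum_coe_sort p.coeff.support fun α => Real.exp (pairing (realExponent α) y),
    Finset.sum_coe_sort p.coeff.support
      fun α => p.coeff α * (Real.exp (pairing (realExponent α) y) : ℂ)] at this
  simpa only [MvLaurent.eval, prod_exp_zpow] using this

theorem exp_pairing_le_sum_of_mem_newtonPolytope {n : ℕ} {p : MvLaurent n} {δ : Fin n → ℝ}
    (hδ : δ ∈ newtonPolytope p) (y : Fin n → ℝ) :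
    Real.exp (pairing δ y) ≤ ∑ α ∈ p.coeff.support, Real.exp (pairing (realExponent α) y) := by
  set Z := ∑ α ∈ p.coeff.support, Real.exp (pairing (realExponent α) y) with hZ
  have hle : ∀ α ∈ p.coeff.support, Real.exp (pairing (realExponent α) y) ≤ Z := fun α hα =>
    Finset.single_le_sum (f := fun α => Real.exp (pairing (realExponent α) y))
      (fun _ _ => (Real.exp_pos _).le) hα
  obtain ⟨_, α, hα, rfl⟩ := convexHull_nonempty_iff.1 ⟨δ, hδ⟩
  have hZpos : 0 < Z := (Real.exp_pos _).trans_le (hle α hα)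
  rw [← Real.le_log_iff_exp_le hZpos, pairing_comm]
  refine convexHull_min ?_ (convex_halfSpace_le (pairing y).isLinear (Real.log Z)) hδ
  rintro _ ⟨β, hβ, rfl⟩
  rw [mem_ofPred_eq, pairing_comm, Real.le_log_iff_exp_le hZpos]
  exact hle β hβ

/-- The reciprocal of a completely non-vanishing Laurent polynomial is dominated on the positive
orthant by the monomial `ε^{-δ}`, for each point `δ` of its Newton polytope. -/
theorem exists_prod_rpow_le_mul_norm_eval {n : ℕ} {p : MvLaurent n}
    (hp : CompletelyNonvanishing p (complexPosOrthant n)) {δ : Fin n → ℝ}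
    (hδ : δ ∈ newtonPolytope p) :
    ∃ C > 0, ∀ ε ∈ posOrthant n, ∏ i, ε i ^ δ i ≤ C * ‖p.eval fun i => (ε i : ℂ)‖ := by
  obtain ⟨c, hc, h⟩ := exists_pos_mul_sum_exp_le_norm_eval hp
  refine ⟨c⁻¹, inv_pos.2 hc, fun ε hε => ?_⟩
  have h1 := h fun i => Real.log (ε i)
  have h2 := exp_pairing_le_sum_of_mem_newtonPolytope hδ fun i => Real.log (ε i)
  simp only [fun i => Real.exp_log (hε i)] at h1
  have h3 : ∏ i, ε i ^ δ i = Real.exp (pairing δ fun i => Real.log (ε i)) := by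
    rw [pairing_apply, Real.exp_sum]
    exact Finset.prod_congr rfl fun i _ => by rw [Real.rpow_def_of_pos (hε i), mul_comm]
  rw [h3, inv_mul_eq_div, le_div_iff₀ hc, mul_comm]
  exact (mul_le_mul_of_nonneg_left h2 hc.le).trans h1

/-! ### Rapidly decreasing functions -/

/-- A bounded rapidly decreasing function is `O(∏ (1 + ε_i ^ N)⁻¹)` on the closed orthant: after
expansion of the product each monomial is controlled at infinity by rapid decrease, and on bounded
sets by boundedness. -/
theorem exists_prod_one_add_pow_mul_le {n : ℕ} {φ : (Fin n → ℝ) → ℝ}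
    (hbdd : ∃ M : ℝ, ∀ ε ∈ nonnegOrthant n, |φ ε| ≤ M) (hdecr : RapidlyDecreasing φ) (N : ℕ) :
    ∃ C, ∀ ε ∈ nonnegOrthant n, (∏ i, (1 + ε i ^ N)) * |φ ε| ≤ C := by
  classical
  obtain ⟨M, hM⟩ := hbdd
  have key : ∀ s : Finset (Fin n), ∃ C, ∀ ε ∈ nonnegOrthant n,
      (∏ i ∈ s, ε i ^ N) * |φ ε| ≤ C := fun s => by
    have h1 := hdecr fun i => if i ∈ s then N else 0
    have h2 := h1.norm.eventually_le_const (u := 1) (by simp)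
    rw [eventually_inf_principal] at h2
    obtain ⟨R, hR⟩ := (Bornology.isBounded_def.2 (by rwa [compl_compl] :
      {ε | ε ∈ nonnegOrthant n →
        ‖(∏ i, ε i ^ (if i ∈ s then N else 0)) * φ ε‖ ≤ 1}ᶜᶜ ∈ _)).exists_norm_le
    refine ⟨max 1 ((∏ i ∈ s, R ^ N) * M), fun ε hε => ?_⟩
    by_cases hmem : ‖(∏ i, ε i ^ (if i ∈ s then N else 0)) * φ ε‖ ≤ 1
    · refine le_max_of_le_left (le_trans (le_of_eq ?_) hmem)
      have hpow : ∀ i, ε i ^ (if i ∈ s then N else 0) = if i ∈ s then ε i ^ N else 1 := fun i => by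
        split_ifs <;> simp
      simp only [hpow, Finset.prod_ite_mem, Finset.univ_inter]
      rw [norm_mul, Real.norm_of_nonneg (Finset.prod_nonneg fun i _ => pow_nonneg (hε i) N),
        Real.norm_eq_abs]
    · have hεR : ‖ε‖ ≤ R := hR ε fun h => hmem (h hε)
      have hR0 : 0 ≤ R := (norm_nonneg _).trans hεR
      refine le_max_of_le_right (mul_le_mul ?_ (hM ε hε) (abs_nonneg _) (by positivity))
      refine Finset.prod_le_prod (fun i _ => pow_nonneg (hε i) N) fun i _ => ?_
      exact pow_le_pow_left₀ (hε i)
        ((le_abs_self _).trans ((norm_le_pi_norm ε i).trans hεR)) N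
  choose C hC using key
  refine ⟨∑ s ∈ Finset.univ.powerset, C s, fun ε hε => ?_⟩
  rw [Finset.prod_one_add, Finset.sum_mul]
  exact Finset.sum_le_sum fun s _ => hC s ε hε

/-! ### Integrable products on the positive orthant -/

theorem integrableOn_Ioi_rpow_div_one_add_pow {a : ℝ} {N : ℕ} (ha : 0 < a) (haN : a < N) :
    IntegrableOn (fun t : ℝ => t ^ (a - 1) / (1 + t ^ N)) (Ioi 0) := by
  have hmeas : Measurable fun t : ℝ => t ^ (a - 1) / (1 + t ^ N) := by fun_prop
  rw [← Ioc_union_Ioi_eq_Ioi zero_le_one]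
  refine IntegrableOn.union ?_ ?_
  · have h : IntegrableOn (fun t : ℝ => t ^ (a - 1)) (Ioc 0 1) :=
      (intervalIntegrable_iff_integrableOn_Ioc_of_le zero_le_one).1
        (intervalIntegral.intervalIntegrable_rpow' (by linarith))
    refine h.mono' hmeas.aestronglyMeasurable
      ((ae_restrict_iff' measurableSet_Ioc).2 (Eventually.of_forall fun t ht => ?_))
    have ht0 : 0 < t := ht.1
    rw [Real.norm_of_nonneg (by positivity)]
    exact div_le_self (by positivity) (by linarith [pow_pos ht0 N])
  · have h : IntegrableOn (fun t : ℝ => t ^ (a - 1 - N)) (Ioi 1) :=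
      integrableOn_Ioi_rpow_of_lt (by linarith) one_pos
    refine h.mono' hmeas.aestronglyMeasurable
      ((ae_restrict_iff' measurableSet_Ioi).2 (Eventually.of_forall fun t ht => ?_))
    have ht0 : 0 < t := one_pos.trans ht
    rw [Real.norm_of_nonneg (by positivity), Real.rpow_sub ht0 _ N,
      Real.rpow_natCast]
    gcongr
    linarith

theorem integrableOn_posOrthant_prod {n : ℕ} {f : Fin n → ℝ → ℝ}
    (hf : ∀ i, IntegrableOn (f i) (Ioi 0)) :
    IntegrableOn (fun ε : Fin n → ℝ => ∏ i, f i (ε i)) (posOrthant n) := by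
  have hset : posOrthant n = Set.univ.pi fun _ => Ioi (0 : ℝ) := by
    ext; simp [posOrthant]
  rw [IntegrableOn, hset, volume_pi, Measure.restrict_pi_pi]
  exact Integrable.fintype_prod hf

theorem measurableSet_posOrthant (n : ℕ) : MeasurableSet (posOrthant n) := by
  have hset : posOrthant n = Set.univ.pi fun _ => Ioi (0 : ℝ) := by
    ext; simp [posOrthant]
  rw [hset]
  exact MeasurableSet.univ_pi fun _ => measurableSet_Ioi

/-! ### Dependence of the Mellin integrand on the parameter -/

theorem measurable_eval {n : ℕ} (p : MvLaurent n) :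
    Measurable fun ε : Fin n → ℝ => p.eval fun i => (ε i : ℂ) := by
  unfold MvLaurent.eval
  fun_prop

theorem aestronglyMeasurable_mellinIntegrand {n : ℕ} {φ : (Fin n → ℝ) → ℝ}
    (hmeas : AEMeasurable φ (volume.restrict (nonnegOrthant n))) (p : MvLaurent n)
    (s : Fin n → ℂ) :
    AEStronglyMeasurable (mellinIntegrand (quotient φ p) s)
      (volume.restrict (posOrthant n)) := by
  have hφ : AEMeasurable φ (volume.restrict (posOrthant n)) :=
    hmeas.mono_set fun ε hε i => (hε i).le
  have hprod : Measurable fun ε : Fin n → ℝ => ∏ i, (ε i : ℂ) ^ (s i - 1) := by fun_prop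
  exact (hprod.aemeasurable.mul
    ((Complex.measurable_ofReal.comp_aemeasurable hφ).div
      (measurable_eval p).aemeasurable)).aestronglyMeasurable

/-- Moving the parameter from `s₀` to `s` multiplies the integrand by the exponential of a linear
form in `s - s₀`. -/
theorem mellinIntegrand_eq_mul_cexp {n : ℕ} (g : (Fin n → ℝ) → ℂ) (s₀ s : Fin n → ℂ)
    {ε : Fin n → ℝ} (hε : ε ∈ posOrthant n) :
    mellinIntegrand g s ε =
      mellinIntegrand g s₀ ε * Complex.exp (∑ i, (Real.log (ε i) : ℂ) * (s - s₀) i) := by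
  have h : ∀ i, (ε i : ℂ) ^ (s i - 1) =
      (ε i : ℂ) ^ (s₀ i - 1) * Complex.exp ((Real.log (ε i) : ℂ) * (s - s₀) i) := fun i => by
    have h0 : (ε i : ℂ) ≠ 0 := Complex.ofReal_ne_zero.2 (hε i).ne'
    rw [Complex.cpow_def_of_ne_zero h0, Complex.cpow_def_of_ne_zero h0, ← Complex.exp_add,
      Complex.ofReal_log (hε i).le, Pi.sub_apply]
    ring_nf
  simp only [mellinIntegrand, h, Finset.prod_mul_distrib, Complex.exp_sum]
  ring

/-- The continuous linear functional `h ↦ ∑ log(ε_i) h_i` on `ℂ^n`. -/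
noncomputable def logPairing {n : ℕ} (ε : Fin n → ℝ) : (Fin n → ℂ) →L[ℂ] ℂ :=
  ∑ i, (Real.log (ε i) : ℂ) • ContinuousLinearMap.proj i

theorem logPairing_apply {n : ℕ} (ε : Fin n → ℝ) (h : Fin n → ℂ) :
    logPairing ε h = ∑ i, (Real.log (ε i) : ℂ) * h i := by
  simp [logPairing]

theorem norm_logPairing_le {n : ℕ} (ε : Fin n → ℝ) :
    ‖logPairing ε‖ ≤ ∑ i, |Real.log (ε i)| := by
  refine ContinuousLinearMap.opNorm_le_bound _ (by positivity) fun h => ?_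
  rw [logPairing_apply, Finset.sum_mul]
  refine norm_sum_le_of_le _ fun i _ => ?_
  rw [norm_mul, Complex.norm_real, Real.norm_eq_abs]
  gcongr
  exact norm_le_pi_norm h i

theorem aestronglyMeasurable_logPairing {n : ℕ} (μ : Measure (Fin n → ℝ)) :
    AEStronglyMeasurable (logPairing (n := n)) μ := by
  unfold logPairing
  refine Finset.aestronglyMeasurable_fun_sum _ fun i _ => AEStronglyMeasurable.smul_const ?_ _
  have : Measurable fun ε : Fin n → ℝ => (Real.log (ε i) : ℂ) := by fun_prop
  exact this.aestronglyMeasurable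

theorem exp_mul_norm_logPairing_le {n : ℕ} {r : ℝ} (hr : 0 ≤ r) {ε : Fin n → ℝ}
    (hε : ε ∈ posOrthant n) :
    Real.exp (r * ‖logPairing ε‖) ≤ ∏ i, (ε i ^ r + ε i ^ (-r)) := by
  calc Real.exp (r * ‖logPairing ε‖) ≤ Real.exp (∑ i, r * |Real.log (ε i)|) := by
        rw [← Finset.mul_sum]
        gcongr
        exact norm_logPairing_le ε
    _ = ∏ i, Real.exp (r * |Real.log (ε i)|) := Real.exp_sum _ _
    _ ≤ _ := by
        refine Finset.prod_le_prod (fun _ _ => (Real.exp_pos _).le) fun i _ => ?_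
        rw [Real.rpow_def_of_pos (hε i), Real.rpow_def_of_pos (hε i)]
        rcases abs_cases (Real.log (ε i)) with ⟨h, -⟩ | ⟨h, -⟩ <;> rw [h]
        · rw [mul_comm]
          linarith [Real.exp_pos (Real.log (ε i) * -r)]
        · rw [show r * -Real.log (ε i) = Real.log (ε i) * -r by ring]
          linarith [Real.exp_pos (Real.log (ε i) * r)]

/-! ### Analyticity of integrals of exponentials -/

/-- A Laplace type integral is analytic in its parameter as soon as it converges absolutely with an
exponential weight to spare: the exponential series may be integrated term by term. -/
theorem analyticAt_integral_mul_cexp {X E : Type*} [MeasurableSpace X] {μ : Measure X}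
    [NormedAddCommGroup E] [NormedSpace ℂ E] {F : X → ℂ} {L : X → E →L[ℂ] ℂ} {r : ℝ} (hr : 0 < r)
    (hF : AEStronglyMeasurable F μ) (hL : AEStronglyMeasurable L μ)
    (hint : Integrable (fun x => ‖F x‖ * Real.exp (r * ‖L x‖)) μ) :
    AnalyticAt ℂ (fun h => ∫ x, F x * Complex.exp (L x h) ∂μ) 0 := by
  -- the `k`-th term of the exponential series, as a multilinear map
  let m : ∀ k : ℕ, X → ContinuousMultilinearMap ℂ (fun _ : Fin k => E) ℂ := fun k x =>
    (F x * (k.factorial : ℂ)⁻¹) •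
      (ContinuousMultilinearMap.mkPiAlgebraFin ℂ k ℂ).compContinuousLinearMap fun _ => L x
  have hm_apply : ∀ k x h, m k x (fun _ => h) = F x * ((k.factorial : ℂ)⁻¹ * L x h ^ k) := by
    intro k x h
    simp [m, mul_assoc]
  have hbound : ∀ k x, ‖m k x‖ * r ^ k ≤ ‖F x‖ * ((r * ‖L x‖) ^ k / k.factorial) := by
    intro k x
    have h1 := ContinuousMultilinearMap.norm_compContinuousLinearMap_le
      (ContinuousMultilinearMap.mkPiAlgebraFin ℂ k ℂ) (fun _ => L x)
    simp only [ContinuousMultilinearMap.norm_mkPiAlgebraFin, Finset.prod_const, Finset.card_univ,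
      Fintype.card_fin, one_mul] at h1
    have h2 : ‖m k x‖ ≤ ‖F x‖ * (k.factorial : ℝ)⁻¹ * ‖L x‖ ^ k := by
      rw [norm_smul, norm_mul, norm_inv, Complex.norm_natCast]
      gcongr
    calc ‖m k x‖ * r ^ k ≤ ‖F x‖ * (k.factorial : ℝ)⁻¹ * ‖L x‖ ^ k * r ^ k := by gcongr
      _ = _ := by rw [mul_pow]; ring
  have hbound' : ∀ k x, ‖m k x‖ * r ^ k ≤ ‖F x‖ * Real.exp (r * ‖L x‖) := fun k x =>
    (hbound k x).trans (mul_le_mul_of_nonneg_left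
      (Real.pow_div_factorial_le_exp _ (by positivity) k) (norm_nonneg _))
  have hm_meas : ∀ k, AEStronglyMeasurable (m k) μ := fun k => by
    refine (hF.mul_const _).smul ?_
    have hc : Continuous fun f : E →L[ℂ] ℂ =>
        (ContinuousMultilinearMap.mkPiAlgebraFin ℂ k ℂ).compContinuousLinearMap fun _ => f :=
      (ContinuousMultilinearMap.compContinuousLinearMapContinuousMultilinear ℂ
        (fun _ : Fin k => E) (fun _ : Fin k => ℂ) ℂ).cont.clm_apply continuous_const |>.comp
        (continuous_pi fun _ => continuous_id)
    exact hc.comp_aestronglyMeasurable hL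
  have hm_int : ∀ k, Integrable (m k) μ := fun k => by
    refine (hint.mul_const ((r ^ k)⁻¹)).mono' (hm_meas k) (Eventually.of_forall fun x => ?_)
    rw [← div_eq_mul_inv, le_div_iff₀ (by positivity)]
    exact hbound' k x
  let q : FormalMultilinearSeries ℂ E ℂ := fun k => ∫ x, m k x ∂μ
  have hq_apply : ∀ k h, q k (fun _ => h) = ∫ x, F x * ((k.factorial : ℂ)⁻¹ * L x h ^ k) ∂μ := by
    intro k h
    have := (ContinuousMultilinearMap.apply ℂ (fun _ : Fin k => E) ℂ (fun _ => h)).integral_comp_comm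
      (hm_int k)
    simp only [ContinuousMultilinearMap.apply_apply, hm_apply] at this
    exact this.symm
  refine ⟨q, ENNReal.ofReal r, ?_, by simpa using hr, ?_⟩
  · refine q.le_radius_of_bound (r := r.toNNReal) (∫ x, ‖F x‖ * Real.exp (r * ‖L x‖) ∂μ) fun k => ?_
    rw [Real.coe_toNNReal r hr.le]
    calc ‖q k‖ * r ^ k ≤ (∫ x, ‖m k x‖ ∂μ) * r ^ k := by
          gcongr
          exact norm_integral_le_integral_norm _
      _ = ∫ x, ‖m k x‖ * r ^ k ∂μ := (integral_mul_const _ _).symm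
      _ ≤ _ := integral_mono ((hm_int k).norm.mul_const _) hint (hbound' k)
  · intro h hh
    have hh' : ‖h‖ ≤ r := by
      rw [Metric.eball_ofReal, mem_ball_zero_iff] at hh
      exact hh.le
    simp only [hq_apply, zero_add]
    have hLh : AEStronglyMeasurable (fun x => L x h) μ :=
      (ContinuousLinearMap.apply ℂ ℂ h).continuous.comp_aestronglyMeasurable hL
    have hexpsum : ∀ t : ℝ, HasSum (fun k : ℕ => t ^ k / k.factorial) (Real.exp t) := fun t => by
      rw [Real.exp_eq_exp_ℝ]
      exact NormedSpace.expSeries_div_hasSum_exp t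
    refine hasSum_integral_of_dominated_convergence
      (fun k x => ‖F x‖ * ((r * ‖L x‖) ^ k / k.factorial)) (fun k => ?_) (fun k => ?_) ?_ ?_ ?_
    · exact hF.mul ((hLh.pow k).const_mul _)
    · refine Eventually.of_forall fun x => ?_
      rw [norm_mul, norm_mul, norm_inv, Complex.norm_natCast, norm_pow, ← div_eq_inv_mul]
      gcongr
      calc ‖L x h‖ ≤ ‖L x‖ * ‖h‖ := (L x).le_opNorm h
        _ ≤ ‖L x‖ * r := by gcongr
        _ = r * ‖L x‖ := mul_comm _ _
    · exact Eventually.of_forall fun x => ((hexpsum _).mul_left _).summable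
    · simpa only [((hexpsum _).mul_left _).tsum_eq] using hint
    · refine Eventually.of_forall fun x => ?_
      have := (NormedSpace.expSeries_div_hasSum_exp (L x h)).mul_left (F x)
      rw [← Complex.exp_eq_exp_ℂ] at this
      simpa only [div_eq_inv_mul] using this

/-! ### Convergence and analyticity of the Mellin transform -/

theorem norm_mellinIntegrand_quotient {n : ℕ} (φ : (Fin n → ℝ) → ℝ) (p : MvLaurent n)
    (s : Fin n → ℂ) {ε : Fin n → ℝ} (hε : ε ∈ posOrthant n) :
    ‖mellinIntegrand (quotient φ p) s ε‖ =
      (∏ i, ε i ^ ((s i).re - 1)) * (|φ ε| / ‖p.eval fun i => (ε i : ℂ)‖) := by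
  rw [mellinIntegrand, quotient, norm_mul, norm_prod, norm_div, Complex.norm_real,
    Real.norm_eq_abs]
  congr 1
  refine Finset.prod_congr rfl fun i _ => ?_
  rw [Complex.norm_cpow_eq_rpow_re_of_pos (hε i), Complex.sub_re, Complex.one_re]

/-- The domination behind both halves of the theorem. The weight `exp (r ‖logPairing ε‖)` leaves
room for moving `s` within a ball of radius `r`. -/
theorem exists_integrable_norm_mul_exp_logPairing {n : ℕ} {φ : (Fin n → ℝ) → ℝ}
    (hmeas : AEMeasurable φ (volume.restrict (nonnegOrthant n)))
    (hbdd : ∃ M : ℝ, ∀ ε ∈ nonnegOrthant n, |φ ε| ≤ M) (hdecr : RapidlyDecreasing φ)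
    {p : MvLaurent n} (hp : CompletelyNonvanishing p (complexPosOrthant n)) {s : Fin n → ℂ}
    (hs : s ∈ tube (newtonPolytope p + posOrthant n)) :
    ∃ r > 0, Integrable
      (fun ε => ‖mellinIntegrand (quotient φ p) s ε‖ * Real.exp (r * ‖logPairing ε‖))
      (volume.restrict (posOrthant n)) := by
  obtain ⟨δ, hδ, τ, hτ, hsum⟩ := hs
  have hre : ∀ i, (s i).re = δ i + τ i := fun i => (congrFun hsum i).symm
  obtain ⟨r, hr, hrτ⟩ : ∃ r > 0, ∀ i, r < τ i := by
    have h : ∀ᶠ r in 𝓝[>] (0 : ℝ), ∀ i, r < τ i :=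
      eventually_all.2 fun i => (eventually_lt_nhds (hτ i)).filter_mono nhdsWithin_le_nhds
    exact (eventually_mem_nhdsWithin.and h).exists
  obtain ⟨N, hN⟩ : ∃ N : ℕ, ∀ i, τ i + r < N :=
    (eventually_all.2 fun i => tendsto_natCast_atTop_atTop.eventually_gt_atTop (τ i + r)).exists
  obtain ⟨C, hC, hCp⟩ := exists_prod_rpow_le_mul_norm_eval hp hδ
  obtain ⟨D, hD⟩ := exists_prod_one_add_pow_mul_le hbdd hdecr N
  refine ⟨r, hr, ?_⟩
  -- one-variable factors of the dominating function
  let f : Fin n → ℝ → ℝ := fun i t =>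
    t ^ (τ i + r - 1) / (1 + t ^ N) + t ^ (τ i - r - 1) / (1 + t ^ N)
  have hf : IntegrableOn (fun ε : Fin n → ℝ => ∏ i, f i (ε i)) (posOrthant n) :=
    integrableOn_posOrthant_prod fun i =>
      (integrableOn_Ioi_rpow_div_one_add_pow (by linarith [hrτ i]) (hN i)).add
        (integrableOn_Ioi_rpow_div_one_add_pow (by linarith [hrτ i]) (by linarith [hN i]))
  refine (hf.const_mul (C * D)).mono' ?_ ?_
  · exact (aestronglyMeasurable_mellinIntegrand hmeas p s).norm.mul
      (Real.continuous_exp.comp_aestronglyMeasurable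
        ((aestronglyMeasurable_logPairing _).norm.const_mul r))
  · refine (ae_restrict_iff' (measurableSet_posOrthant n)).2 (Eventually.of_forall fun ε hε => ?_)
    have hfprod : ∏ i, f i (ε i) = (∏ i, ε i ^ (τ i - 1)) * (∏ i, (ε i ^ r + ε i ^ (-r))) /
        ∏ i, (1 + ε i ^ N) := by
      rw [← Finset.prod_mul_distrib, ← Finset.prod_div_distrib]
      refine Finset.prod_congr rfl fun i _ => ?_
      simp only [f]
      rw [mul_add, ← Real.rpow_add (hε i), ← Real.rpow_add (hε i), ← add_div]
      ring_nf
    have hsplit : ∏ i, ε i ^ ((s i).re - 1) = (∏ i, ε i ^ (τ i - 1)) * ∏ i, ε i ^ δ i := by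
      rw [← Finset.prod_mul_distrib]
      refine Finset.prod_congr rfl fun i _ => ?_
      rw [← Real.rpow_add (hε i), hre]
      ring_nf
    have hP : 0 < ‖p.eval fun i => (ε i : ℂ)‖ := norm_pos_iff.2 (hp.1 _ ⟨ε, hε, rfl⟩)
    have hτpos : 0 < ∏ i, ε i ^ (τ i - 1) :=
      Finset.prod_pos fun i _ => Real.rpow_pos_of_pos (hε i) _
    have hNpos : 0 < ∏ i, (1 + ε i ^ N) :=
      Finset.prod_pos fun i _ => by linarith [pow_pos (hε i) N]
    have hrpos : 0 < ∏ i, (ε i ^ r + ε i ^ (-r)) :=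
      Finset.prod_pos fun i _ => add_pos (Real.rpow_pos_of_pos (hε i) _)
        (Real.rpow_pos_of_pos (hε i) _)
    have hφ : |φ ε| ≤ D / ∏ i, (1 + ε i ^ N) := by
      rw [le_div_iff₀ hNpos, mul_comm]
      exact hD ε fun i => (hε i).le
    have h1 : ‖mellinIntegrand (quotient φ p) s ε‖ ≤
        (∏ i, ε i ^ (τ i - 1)) * (C * (D / ∏ i, (1 + ε i ^ N))) := by
      rw [norm_mellinIntegrand_quotient φ p s hε, hsplit, mul_assoc]
      refine mul_le_mul_of_nonneg_left ?_ hτpos.le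
      rw [← mul_div_assoc, div_le_iff₀ hP]
      calc (∏ i, ε i ^ δ i) * |φ ε|
          ≤ (C * ‖p.eval fun i => (ε i : ℂ)‖) * (D / ∏ i, (1 + ε i ^ N)) :=
            mul_le_mul (hCp ε hε) hφ (abs_nonneg _) (by positivity)
        _ = _ := by ring
    rw [Real.norm_of_nonneg (by positivity), hfprod]
    calc _ ≤ (∏ i, ε i ^ (τ i - 1)) * (C * (D / ∏ i, (1 + ε i ^ N))) *
          ∏ i, (ε i ^ r + ε i ^ (-r)) :=
        mul_le_mul h1 (exp_mul_norm_logPairing_le hr.le hε) (Real.exp_pos _).le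
          ((norm_nonneg _).trans h1)
      _ = _ := by ring

end NewtonMellin

theorem mainTheorem4 (n : ℕ) (φ : (Fin n → ℝ) → ℝ)
    (hmeas : AEMeasurable φ (volume.restrict (NewtonMellin.nonnegOrthant n)))
    (hbdd : ∃ M : ℝ, ∀ ε ∈ NewtonMellin.nonnegOrthant n, |φ ε| ≤ M)
    (hdecr : NewtonMellin.RapidlyDecreasing φ)
    (p : NewtonMellin.MvLaurent n)
    (hp : NewtonMellin.CompletelyNonvanishing p (NewtonMellin.complexPosOrthant n)) :
    (∀ s ∈ NewtonMellin.tube (NewtonMellin.newtonPolytope p + NewtonMellin.posOrthant n),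
      IntegrableOn (NewtonMellin.mellinIntegrand (NewtonMellin.quotient φ p) s)
        (NewtonMellin.posOrthant n) volume) ∧
    AnalyticOnNhd ℂ (NewtonMellin.mellinTransform (NewtonMellin.quotient φ p))
      (NewtonMellin.tube (NewtonMellin.newtonPolytope p + NewtonMellin.posOrthant n)) := by
  open NewtonMellin in
  refine ⟨fun s hs => ?_, fun s hs => ?_⟩
  · obtain ⟨r, hr, hint⟩ := exists_integrable_norm_mul_exp_logPairing hmeas hbdd hdecr hp hs
    refine hint.mono' (aestronglyMeasurable_mellinIntegrand hmeas p s)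
      (Eventually.of_forall fun ε => le_mul_of_one_le_right (norm_nonneg _) ?_)
    exact Real.one_le_exp (by positivity)
  · obtain ⟨r, hr, hint⟩ := exists_integrable_norm_mul_exp_logPairing hmeas hbdd hdecr hp hs
    have h := analyticAt_integral_mul_cexp hr (aestronglyMeasurable_mellinIntegrand hmeas p s)
      (aestronglyMeasurable_logPairing _) hint
    -- recentre the transform at `s`
    have heq : mellinTransform (quotient φ p) = (fun h => ∫ ε in posOrthant n,
        mellinIntegrand (quotient φ p) s ε * Complex.exp (logPairing ε h)) ∘ fun z => z - s := by
      funext z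
      refine setIntegral_congr_fun (measurableSet_posOrthant n) fun ε hε => ?_
      simp only [logPairing_apply]
      exact mellinIntegrand_eq_mul_cexp _ s z hε
    rw [heq]
    refine AnalyticAt.comp ?_ (analyticAt_id.sub analyticAt_const)
    simpa using h
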